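/- Let $G$ be a finite group and let $C(G)$ be the set of cyclic subgroups of $G$, partially ordered by inclusion. A breaking point of $C(G)$ is a cyclic subgroup $H$ of $G$ with $1 \neq H \neq G$ such that, for every cyclic subgroup $X$ of $G$, either $X \le H$ or $H \le X$. A generalized quaternion $2$-group is a group isomorphic to $$Q_{2^n}=\langle a,b \mid a^{2^{n-2}}=b^2,\ a^{2^{n-1}}=1,\ b^{-1}ab=a^{-1}\rangle$$ (a group of order $2^n$) for some integer $n\ge 3$. Then: 1. $C(G)$ has exactly one breaking point if and only if $G$ is either cyclic of order $p^2$ for some prime $p$ or a generalized quaternion $2$-group. 2. $G$ is noncyclic and $C(G)$ has exactly one breaking point if and only if $G$ is a generalized quaternion $2$-group. 3. If $G$ is a generalized quaternion $2$-group, then $G$ has exactly one subgroup of order $2$, and a subgroup of $G$ is a breaking point of $C(G)$ if and only if it has order $2$. -/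

import Mathlib

/-- The poset `C(G)` of cyclic subgroups of `G`, as a set of subgroups ordered by inclusion. -/
def cyclicSubgroups (G : Type*) [Group G] : Set (Subgroup G) :=
  {H | IsCyclic H}

/-- `H` is a breaking point of a poset `S` of subgroups of `G`: it is a proper nontrivial
subgroup belonging to `S` that is comparable with every member of `S`. -/
def IsBreakingPoint {G : Type*} [Group G] (S : Set (Subgroup G)) (H : Subgroup G) : Prop :=
  H ∈ S ∧ H ≠ ⊥ ∧ H ≠ ⊤ ∧ ∀ X ∈ S, X ≤ H ∨ H ≤ X

/-- `G` is a generalized quaternion 2-group `Q_{2^n}`, `n ≥ 3`. Mathlib's `QuaternionGroup k`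
has order `4 * k`, so the group of order `2 ^ n` is the one with `k = 2 ^ (n - 2)`. -/
def IsGeneralizedQuaternion (G : Type*) [Group G] : Prop :=
  ∃ n : ℕ, 3 ≤ n ∧ Nonempty (G ≃* QuaternionGroup (2 ^ (n - 2)))

open Subgroup

/-! A breaking point `H` misses some element `y` of prime power order, so `H ≤ ⟨y⟩` is a `p`-group;
comparing `H` with elements of prime order shows that `G` is a `p`-group whose only subgroup of
order `p` lies in `H`. By the classical theorem (`IsPGroup.isCyclic_or_isGeneralizedQuaternion`),
`G` is then cyclic or generalized quaternion.

That theorem rests on a maximal normal cyclic `⟨a⟩`, which is self-centralizing. If `b ∉ ⟨a⟩`, `b ^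
p ∈ ⟨a⟩` and `b` acts by `a ↦ a ^ r`, then `r ≡ 1` mod `p`. When `1 + r + ⋯ + r ^ (p - 1)` is `p`
times a unit, the coset `⟨a⟩ b` contains a solution of `x ^ p = 1`, which is impossible. This
excludes odd `p`, and `r ≡ 1` mod 4 when `p = 2`; what survives is the quaternion presentation.

In a cyclic `p`-group every proper nontrivial subgroup is a breaking point, so there is exactly one
only for order `p ^ 2`. In a quaternion group a breaking point lies in two distinct maximal cyclic
subgroups of order 4, hence has order 2. -/

theorem IsPGroup.exists_pow_notMem_pow_mem {G : Type*} [Group G] {p : ℕ} (hG : IsPGroup p G)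
    {A : Subgroup G} {b : G} (hb : b ∉ A) :
    ∃ k : ℕ, b ^ p ^ k ∉ A ∧ (b ^ p ^ k) ^ p ∈ A := by
  classical
  have h : ∃ k : ℕ, b ^ p ^ k ∈ A := by
    obtain ⟨k, hk⟩ := hG b
    exact ⟨k, hk ▸ A.one_mem⟩
  obtain ⟨m, hm⟩ : ∃ m, Nat.find h = m + 1 :=
    Nat.exists_eq_succ_of_ne_zero fun h0 ↦ hb (by simpa [h0] using Nat.find_spec h)
  refine ⟨m, Nat.find_min h (by omega), ?_⟩
  rw [← pow_mul, ← pow_succ, ← hm]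
  exact Nat.find_spec h

/-! ### Powers of elements normalizing a cyclic subgroup. -/

theorem conj_zpow_eq {G : Type*} [Group G] {a b : G} {r : ℤ} (h : b * a * b⁻¹ = a ^ r) (i : ℤ) :
    b * a ^ i * b⁻¹ = a ^ (r * i) := by
  rw [← conj_zpow, h, zpow_mul]

theorem conj_pow_zpow_eq {G : Type*} [Group G] {a b : G} {r : ℤ} (h : b * a * b⁻¹ = a ^ r)
    (n : ℕ) : b ^ n * a * (b ^ n)⁻¹ = a ^ (r ^ n) := by
  induction n with
  | zero => simp
  | succ n ih =>
    have : b ^ (n + 1) * a * (b ^ (n + 1))⁻¹ = b * (b ^ n * a * (b ^ n)⁻¹) * b⁻¹ := by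
      rw [pow_succ']; group
    rw [this, ih, conj_zpow_eq h, pow_succ']

theorem zpow_mul_pow_eq_of_conj {G : Type*} [Group G] {a b : G} {r : ℤ}
    (h : b * a * b⁻¹ = a ^ r) (i : ℤ) (n : ℕ) :
    (a ^ i * b) ^ n = a ^ (i * ∑ j ∈ Finset.range n, r ^ j) * b ^ n := by
  induction n with
  | zero => simp
  | succ n ih =>
    have h2 : b * a ^ (i * ∑ j ∈ Finset.range n, r ^ j)
        = a ^ (r * (i * ∑ j ∈ Finset.range n, r ^ j)) * b := by
      rw [← conj_zpow_eq h]; group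
    rw [pow_succ', ih, mul_assoc, ← mul_assoc b, h2, geom_sum_succ, pow_succ', mul_assoc,
      ← mul_assoc (a ^ i), ← zpow_add]
    congr 2
    ring

/-- If `b` acts on `⟨a⟩` by `a ↦ a ^ r`, the sum `1 + r + ⋯ + r ^ (p - 1)` is `p` times a unit, and
`b ^ p` is a `p`-th power in `⟨a⟩`, then `⟨a⟩ b` contains a solution of `x ^ p = 1`. -/
theorem mem_zpowers_of_geom_sum_eq {G : Type*} [Group G] {p : ℕ} {a b : G}
    (hA : ∀ x : G, x ^ p = 1 → x ∈ zpowers a) {r k u : ℤ}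
    (h : b * a * b⁻¹ = a ^ r) (hb : b ^ p = a ^ (p * k))
    (hS : ∑ j ∈ Finset.range p, r ^ j = p * u) (hu : IsCoprime u (orderOf a : ℤ)) :
    b ∈ zpowers a := by
  obtain ⟨v, w, hvw⟩ := hu
  -- With `v` inverse to `u` modulo the order of `a`, the exponent `-(k * v) * (p * u)` cancels `p *
  -- k`.
  have key : (a ^ (-(k * v)) * b) ^ p = 1 := by
    rw [zpow_mul_pow_eq_of_conj h, hS, hb, ← zpow_add,
      show -(k * v) * (p * u) + p * k = (orderOf a : ℤ) * (p * k * w) by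
        linear_combination (-(p * k : ℤ)) * hvw, zpow_mul, zpow_natCast, pow_orderOf_eq_one,
      one_zpow]
  have h1 := mul_mem (zpow_mem (mem_zpowers a) (k * v)) (hA _ key)
  rwa [← mul_assoc, ← zpow_add, add_neg_cancel, zpow_zero, one_mul] at h1

theorem IsPGroup.isCoprime_orderOf {G : Type*} [Group G] {p : ℕ} [hp : Fact p.Prime]
    (hG : IsPGroup p G) (a : G) {u : ℤ} (hu : ¬ (p : ℤ) ∣ u) : IsCoprime u (orderOf a : ℤ) := by
  obtain ⟨m, hm⟩ := IsPGroup.iff_orderOf.mp hG a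
  rw [hm]
  push_cast
  exact (((Nat.prime_iff_prime_int.mp hp.out).coprime_iff_not_dvd.mpr hu).symm).pow_right

theorem IsPGroup.mem_zpowers_zpow {G : Type*} [Group G] {p : ℕ} [Fact p.Prime]
    (hG : IsPGroup p G) (a : G) {j : ℤ} (hj : ¬ (p : ℤ) ∣ j) : a ∈ zpowers (a ^ j) := by
  obtain ⟨v, w, hvw⟩ := hG.isCoprime_orderOf a hj
  refine ⟨v, ?_⟩
  change (a ^ j) ^ v = a
  rw [← zpow_mul, show j * v = 1 - orderOf a * w by linear_combination hvw, zpow_sub, zpow_mul]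
  simp

/-! ### Self-centralizing normal cyclic subgroups. -/

theorem IsPGroup.exists_mem_center_of_normal {G : Type*} [Group G] [Finite G] {p : ℕ}
    [Fact p.Prime] (hG : IsPGroup p G) (N : Subgroup G) [N.Normal] (hN : N ≠ ⊥) :
    ∃ x ∈ N, x ∈ center G ∧ x ≠ 1 := by
  have hd : p ∣ Nat.card N := (hG.to_subgroup N).card_eq_or_dvd.resolve_left
    (fun h ↦ hN (Subgroup.card_eq_one.mp h))
  obtain ⟨b, hb, hne⟩ :=
    (hG.of_equiv ConjAct.toConjAct).exists_fixed_point_of_prime_dvd_card_of_fixed_point N hd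
      (a := (1 : N)) (fun g ↦ smul_one g)
  refine ⟨b, b.2, mem_center_iff.mpr fun g ↦ ?_, fun h ↦ hne (Subtype.ext h.symm)⟩
  have := congrArg Subtype.val (hb (ConjAct.toConjAct g))
  rw [ConjAct.Subgroup.val_conj_smul, ConjAct.toConjAct_smul] at this
  exact mul_inv_eq_iff_eq_mul.mp this

/-- In a finite `p`-group, a maximal normal cyclic subgroup containing all solutions of
`x ^ p = 1` is self-centralizing. -/
theorem IsPGroup.mem_zpowers_of_commute {G : Type*} [Group G] [Finite G] {p : ℕ}
    [hp : Fact p.Prime] (hG : IsPGroup p G) {a : G} [hn : (zpowers a).Normal]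
    (hA : ∀ x : G, x ^ p = 1 → x ∈ zpowers a)
    (hmax : ∀ c : G, (zpowers c).Normal → zpowers a ≤ zpowers c → zpowers c ≤ zpowers a)
    {g : G} (hg : Commute g a) : g ∈ zpowers a := by
  by_contra hga
  set A := zpowers a with hAdef
  let C := centralizer (A : Set G)
  have hgC : g ∈ C := by
    rintro _ ⟨i, rfl⟩
    exact (hg.zpow_right i).eq.symm
  have : (C.map (QuotientGroup.mk' A)).Normal :=
    Normal.map inferInstance _ (QuotientGroup.mk'_surjective A)
  have hne : C.map (QuotientGroup.mk' A) ≠ ⊥ := by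
    intro h
    have : QuotientGroup.mk' A g ∈ C.map (QuotientGroup.mk' A) := mem_map_of_mem _ hgC
    rw [h, mem_bot] at this
    exact hga ((QuotientGroup.eq_one_iff g).mp this)
  -- A central element of `G ⧸ A` coming from `C` yields `x ∈ C` outside `A`, central modulo `A`,
  -- with `x ^ p = a ^ j`.
  obtain ⟨_, ⟨y, hyC, rfl⟩, hyc, hy1⟩ := (hG.to_quotient A).exists_mem_center_of_normal _ hne
  have hyA : y ∉ A := fun h ↦ hy1 ((QuotientGroup.eq_one_iff y).mpr h)
  obtain ⟨k, hxA, hxp⟩ := hG.exists_pow_notMem_pow_mem hyA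
  have hxC : y ^ p ^ k ∈ C := pow_mem hyC _
  have hxc : QuotientGroup.mk' A (y ^ p ^ k) ∈ center (G ⧸ A) := by
    rw [map_pow]; exact pow_mem hyc _
  generalize y ^ p ^ k = x at hxA hxp hxC hxc
  have hcomm : x * a * x⁻¹ = a ^ (1 : ℤ) := by
    rw [zpow_one, mul_inv_eq_iff_eq_mul]
    exact (mem_centralizer_iff.mp hxC a (mem_zpowers a)).symm
  obtain ⟨j, hj⟩ := hxp
  change a ^ j = x ^ p at hj
  by_cases hpj : (p : ℤ) ∣ j
  · obtain ⟨k, rfl⟩ := hpj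
    exact hxA (mem_zpowers_of_geom_sum_eq hA hcomm hj.symm (u := 1) (by simp) isCoprime_one_left)
  -- Here `a` is a power of `x`, and `⟨x⟩` is normal because `x` is central modulo `A`; this
  -- contradicts maximality.
  · have hax : A ≤ zpowers x := by
      have h1 := hG.mem_zpowers_zpow a hpj
      rw [hj] at h1
      rw [hAdef, zpowers_le]
      exact (zpowers_le.mpr (pow_mem (mem_zpowers x) p)) h1
    refine hxA (hmax x ⟨?_⟩ hax (mem_zpowers x))
    rintro _ ⟨i, rfl⟩ h
    change h * x ^ i * h⁻¹ ∈ _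
    rw [← conj_zpow]
    refine zpow_mem ?_ _
    have h2 := mem_center_iff.mp hxc (QuotientGroup.mk' A h)
    rw [← map_mul, ← map_mul] at h2
    have h3 : (x * h)⁻¹ * (h * x) ∈ A := QuotientGroup.eq.mp h2.symm
    have h4 := hn.conj_mem _ h3 h
    have h5 : h * x * h⁻¹ = x * (h * ((x * h)⁻¹ * (h * x)) * h⁻¹) := by group
    rw [h5]
    exact mul_mem (mem_zpowers x) (hax h4)

/-- For odd `p` the sum is congruent to `p` modulo `p ^ 2`. This fails for `p = 2`, which is where
quaternion groups enter. -/
theorem Odd.exists_geom_sum_eq_mul {p : ℕ} (hp : p.Prime) (hodd : Odd p) {r : ℤ}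
    (hr : (p : ℤ) ∣ r - 1) :
    ∃ u : ℤ, ∑ j ∈ Finset.range p, r ^ j = p * u ∧ ¬ (p : ℤ) ∣ u := by
  obtain ⟨t, ht⟩ := hr
  obtain rfl : r = 1 + p * t := by linear_combination ht
  obtain ⟨c, hc⟩ := odd_sq_dvd_geom_sum₂_sub (R := ℤ) 1 t hodd
  simp only [one_pow, mul_one] at hc
  refine ⟨1 + p * c, by linear_combination hc, fun h ↦ ?_⟩
  have : (p : ℤ) ∣ 1 := (dvd_add_left (dvd_mul_right _ c)).mp h
  exact (Nat.prime_iff_prime_int.mp hp).not_dvd_one this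

/-- A nontrivial normal cyclic subgroup `⟨a⟩` that contains all solutions of `x ^ p = 1` and is its
own centralizer. -/
structure IsSelfCentralizingGenerator {G : Type*} [Group G] (p : ℕ) (a : G) : Prop where
  ne_one : a ≠ 1
  normal : (zpowers a).Normal
  mem_of_pow_eq_one : ∀ x : G, x ^ p = 1 → x ∈ zpowers a
  mem_of_commute : ∀ x : G, Commute x a → x ∈ zpowers a

theorem IsPGroup.exists_isSelfCentralizingGenerator {G : Type*} [Group G] [Finite G] {p : ℕ}
    [hp : Fact p.Prime] (hG : IsPGroup p G) {z : G} (hz : orderOf z = p)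
    (huniq : ∀ x : G, x ^ p = 1 → x ∈ zpowers z) :
    ∃ a : G, IsSelfCentralizingGenerator p a := by
  have hzn : (zpowers z).Normal := by
    refine ⟨?_⟩
    rintro _ ⟨i, rfl⟩ g
    change g * z ^ i * g⁻¹ ∈ _
    rw [← conj_zpow]
    refine zpow_mem (huniq _ ?_) _
    rw [conj_pow, ← hz, pow_orderOf_eq_one, mul_one, mul_inv_cancel]
  obtain ⟨a, ⟨han, haz⟩, ha⟩ := (Set.toFinite {c : G | (zpowers c).Normal ∧ zpowers z ≤ zpowers c})
    |>.exists_maximalFor orderOf _ ⟨z, hzn, le_rfl⟩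
  have hA : ∀ x : G, x ^ p = 1 → x ∈ zpowers a := fun x hx ↦ haz (huniq x hx)
  refine ⟨a, ?_, han, hA, fun x hx ↦ hG.mem_zpowers_of_commute hA (fun c hc hac ↦ ?_) hx⟩
  · rintro rfl
    rw [zpowers_one_eq_bot, le_bot_iff, zpowers_eq_bot] at haz
    rw [haz, orderOf_one] at hz
    exact hp.out.one_lt.ne hz
  · have h1 : orderOf a ≤ orderOf c := by
      rw [← Nat.card_zpowers, ← Nat.card_zpowers]
      exact Subgroup.card_le_of_le hac
    refine (Subgroup.eq_of_le_of_card_ge hac ?_).ge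
    rw [Nat.card_zpowers, Nat.card_zpowers]
    exact ha ⟨hc, haz.trans hac⟩ h1

/-! ### Elements outside a self-centralizing cyclic subgroup. -/

namespace IsSelfCentralizingGenerator

variable {G : Type*} [Group G] {p : ℕ} {a : G}

/-- Since `b ^ p` centralizes `a`, `r ^ p ≡ 1` mod `p`, and Fermat gives `r ≡ 1`. If `p` did not
divide the exponent of `b ^ p`, then `a` would be a power of `b` and `b` would centralize it. -/
theorem exists_conj_eq (h : IsSelfCentralizingGenerator p a) [hp : Fact p.Prime]
    (hG : IsPGroup p G) {b : G} (hb : b ∉ zpowers a) (hbp : b ^ p ∈ zpowers a) :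
    ∃ r k : ℤ, b * a * b⁻¹ = a ^ r ∧ (p : ℤ) ∣ r - 1 ∧ b ^ p = a ^ (p * k) := by
  obtain ⟨r, hr⟩ := h.normal.conj_mem a (mem_zpowers a) b
  change a ^ r = _ at hr
  obtain ⟨j, hj⟩ := hbp
  change a ^ j = _ at hj
  have hpr : (p : ℤ) ∣ r - 1 := by
    have h1 := conj_pow_zpow_eq hr.symm p
    have h2 : a ^ j * a * (a ^ j)⁻¹ = a := by group
    rw [← hj, h2] at h1
    have h3 : a ^ (r ^ p - 1) = 1 := by rw [zpow_sub, ← h1, zpow_one, mul_inv_cancel]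
    have h4 : (p : ℤ) ∣ r ^ p - 1 :=
      (Int.natCast_dvd_natCast.mpr (hG.dvd_orderOf h.ne_one)).trans
        (orderOf_dvd_iff_zpow_eq_one.mpr h3)
    rw [← ZMod.intCast_zmod_eq_zero_iff_dvd] at h4 ⊢
    push_cast at h4 ⊢
    rwa [ZMod.pow_card] at h4
  have hpj : (p : ℤ) ∣ j := by
    by_contra hpj
    have h1 := hG.mem_zpowers_zpow a hpj
    rw [hj] at h1
    obtain ⟨i, hi⟩ := h1
    refine hb (h.mem_of_commute b ?_)
    change (b ^ p) ^ i = a at hi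
    rw [← hi]
    exact ((Commute.refl b).pow_right p).zpow_right i
  obtain ⟨k, rfl⟩ := hpj
  exact ⟨r, k, hr.symm, hpr, hj.symm⟩

theorem zpowers_eq_top (h : IsSelfCentralizingGenerator p a) [hp : Fact p.Prime]
    (hG : IsPGroup p G) (hodd : Odd p) : zpowers a = ⊤ := by
  rw [eq_top_iff']
  by_contra! ⟨b, hb⟩
  obtain ⟨k, hb, hbp⟩ := hG.exists_pow_notMem_pow_mem hb
  obtain ⟨r, k, hr, hpr, hk⟩ := h.exists_conj_eq hG hb hbp
  obtain ⟨u, hS, hu⟩ := hodd.exists_geom_sum_eq_mul hp.out hpr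
  exact hb (mem_zpowers_of_geom_sum_eq h.mem_of_pow_eq_one hr hk hS (hG.isCoprime_orderOf a hu))

theorem four_dvd_orderOf (h : IsSelfCentralizingGenerator 2 a) (hG : IsPGroup 2 G)
    {b : G} (hb : b ∉ zpowers a) (hb2 : b ^ 2 ∈ zpowers a) : 4 ∣ orderOf a := by
  obtain ⟨r, k, hr, hpr, hk⟩ := h.exists_conj_eq hG hb hb2
  obtain ⟨m, hm⟩ := IsPGroup.iff_orderOf.mp hG a
  match m, hm with
  | 0, hm => exact absurd (orderOf_eq_one_iff.mp (by simpa using hm)) h.ne_one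
  | 1, hm =>
    exfalso
    refine hb (h.mem_of_commute b ?_)
    have h1 : a ^ (r - 1) = 1 := by
      rw [← orderOf_dvd_iff_zpow_eq_one, hm]; simpa using hpr
    have h2 : a ^ r = a := by
      rw [zpow_sub, zpow_one, mul_inv_eq_one] at h1; exact h1
    rw [h2] at hr
    exact mul_inv_eq_iff_eq_mul.mp hr
  | m + 2, hm => exact hm ▸ ⟨2 ^ m, by ring⟩

theorem _root_.zpow_eq_pow_of_sq_eq_one {a : G} {N : ℕ} (hN : orderOf a = 2 * N) {x : G}
    (hx : x ∈ zpowers a) (hx2 : x ^ 2 = 1) (hx1 : x ≠ 1) : x = a ^ N := by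
  obtain ⟨i, rfl⟩ := hx
  dsimp only at hx2 hx1 ⊢
  rw [← zpow_natCast, ← zpow_mul, ← orderOf_dvd_iff_zpow_eq_one, hN] at hx2
  obtain ⟨c, hc⟩ := hx2
  push_cast at hc
  obtain rfl : i = N * c := by linarith
  rcases Int.even_or_odd' c with ⟨d, rfl | rfl⟩
  · refine absurd (orderOf_dvd_iff_zpow_eq_one.mp ⟨d, ?_⟩) hx1
    rw [hN]; push_cast; ring
  · have : a ^ ((N : ℤ) * (2 * d)) = 1 := orderOf_dvd_iff_zpow_eq_one.mp
      ⟨d, by rw [hN]; push_cast; ring⟩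
    rw [mul_add, zpow_add, this, one_mul, mul_one, zpow_natCast]

/-- If `r = 4 * t + 1`, then `1 + r` is twice an odd number, which is excluded. If `r ≡ 3` mod 4,
the fact that `b` commutes with `b ^ 2` forces `b ^ 4 = 1`, so `b ^ 2` is the only involution of
`⟨a⟩`. -/
theorem sq_eq_pow (h : IsSelfCentralizingGenerator 2 a) (hG : IsPGroup 2 G)
    {N : ℕ} (hN : orderOf a = 2 * N) {b : G} (hb : b ∉ zpowers a) (hb2 : b ^ 2 ∈ zpowers a) :
    b ^ 2 = a ^ N := by
  obtain ⟨r, k, hr, hpr, hk⟩ := h.exists_conj_eq hG hb hb2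
  have hr4 : ∃ s : ℤ, r = 4 * s + 3 := by
    by_contra hne
    obtain ⟨t, ht⟩ : ∃ t : ℤ, r = 4 * t + 1 := by
      obtain ⟨q, hq⟩ := hpr
      rcases Int.even_or_odd' q with ⟨d, rfl | rfl⟩
      · exact ⟨d, by push_cast at hq; linarith⟩
      · exact absurd ⟨d, by push_cast at hq; linarith⟩ hne
    refine hb (mem_zpowers_of_geom_sum_eq (u := 2 * t + 1) h.mem_of_pow_eq_one hr hk ?_
      (hG.isCoprime_orderOf a ?_))
    · rw [ht]; simp [Finset.sum_range_succ]; ring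
    · push_cast; omega
  obtain ⟨s, rfl⟩ := hr4
  refine zpow_eq_pow_of_sq_eq_one hN hb2 ?_ fun h1 ↦ hb (h.mem_of_pow_eq_one b h1)
  have h1 := conj_zpow_eq hr ((2 : ℕ) * k)
  rw [← hk, show b * b ^ 2 * b⁻¹ = b ^ 2 by group, hk] at h1
  have h2 : a ^ (2 * (2 * k) * (2 * s + 1)) = 1 := by
    rw [show 2 * (2 * k) * (2 * s + 1) = (4 * s + 3) * ((2 : ℕ) * k) - (2 : ℕ) * k by
      push_cast; ring, zpow_sub, ← h1, mul_inv_cancel]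
  rw [← orderOf_dvd_iff_zpow_eq_one] at h2
  have h3 : (orderOf a : ℤ) ∣ 2 * (2 * k) :=
    (hG.isCoprime_orderOf a (u := 2 * s + 1) (by push_cast; omega)).symm.dvd_of_dvd_mul_right h2
  rw [hk, ← zpow_natCast, ← zpow_mul, ← orderOf_dvd_iff_zpow_eq_one]
  convert h3 using 1
  push_cast; ring

theorem conj_eq_inv (h : IsSelfCentralizingGenerator 2 a) (hG : IsPGroup 2 G)
    {b : G} (hb : b ∉ zpowers a) (hb2 : b ^ 2 ∈ zpowers a) : b * a * b⁻¹ = a⁻¹ := by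
  obtain ⟨N, hN⟩ : 2 ∣ orderOf a := hG.dvd_orderOf h.ne_one
  have h1 := h.sq_eq_pow hG hN hb hb2
  -- Both `b` and `a * b` square to `a ^ N`, so the factor `a * (b * a * b⁻¹)` is trivial.
  have h2 : (a * b) ^ 2 = a * (b * a * b⁻¹) * b ^ 2 := by simp [pow_two, mul_assoc]
  have h3 : (a * b) ^ 2 ∈ zpowers a := by
    rw [h2]
    exact mul_mem (mul_mem (mem_zpowers a) (h.normal.conj_mem a (mem_zpowers a) b)) hb2
  have h4 := h.sq_eq_pow hG hN
    (fun hab ↦ hb ((mul_mem_cancel_left (mem_zpowers a)).mp hab)) h3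
  rw [h2, h1, mul_eq_right] at h4
  exact (inv_eq_of_mul_eq_one_right h4).symm

/-- Otherwise some square `c ^ 2` inverts `a`, so `c` acts by an exponent `s` with `s ^ 2 ≡ -1` mod
4, which has no solution. -/
theorem sq_mem (h : IsSelfCentralizingGenerator 2 a) (hG : IsPGroup 2 G) (g : G) :
    g ^ 2 ∈ zpowers a := by
  by_contra hg
  obtain ⟨k, hb, hb2⟩ := hG.exists_pow_notMem_pow_mem hg
  obtain ⟨c, hc⟩ : ∃ c, (g ^ 2) ^ 2 ^ k = c ^ 2 :=
    ⟨g ^ 2 ^ k, by rw [← pow_mul, ← pow_mul, mul_comm]⟩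
  rw [hc] at hb hb2
  obtain ⟨s, hs⟩ := h.normal.conj_mem a (mem_zpowers a) c
  have h1 := conj_pow_zpow_eq hs.symm 2
  rw [h.conj_eq_inv hG hb hb2] at h1
  have h2 : a ^ (s ^ 2 + 1) = 1 := by rw [zpow_add, ← h1]; simp
  have h3 : (4 : ℤ) ∣ s ^ 2 + 1 :=
    (Int.natCast_dvd_natCast.mpr (h.four_dvd_orderOf hG hb hb2)).trans
      (orderOf_dvd_iff_zpow_eq_one.mpr h2)
  rcases Int.even_or_odd' s with ⟨d, rfl | rfl⟩ <;> ring_nf at h3 <;> omega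

/-- Both elements invert `a`, so `b⁻¹ * g` centralizes it. Thus `⟨a⟩` has index at most 2. -/
theorem inv_mul_mem (h : IsSelfCentralizingGenerator 2 a) (hG : IsPGroup 2 G) {b g : G}
    (hb : b ∉ zpowers a) (hg : g ∉ zpowers a) : b⁻¹ * g ∈ zpowers a := by
  refine h.mem_of_commute _ ?_
  have h1 := h.conj_eq_inv hG hb (h.sq_mem hG b)
  have h2 := h.conj_eq_inv hG hg (h.sq_mem hG g)
  rw [← h1, mul_inv_eq_iff_eq_mul] at h2
  change b⁻¹ * g * a = a * (b⁻¹ * g)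
  rw [mul_assoc, h2]
  group

end IsSelfCentralizingGenerator

/-! ### Recognizing generalized quaternion groups. -/

theorem ZMod.pow_val_add {G : Type*} [Group G] {a : G} {M : ℕ} [NeZero M] (ha : orderOf a = M)
    (i j : ZMod M) : a ^ (i + j).val = a ^ i.val * a ^ j.val := by
  subst ha
  rw [ZMod.val_add, ← pow_add, pow_mod_orderOf]

theorem ZMod.pow_val_sub {G : Type*} [Group G] {a : G} {M : ℕ} [NeZero M] (ha : orderOf a = M)
    (i j : ZMod M) : a ^ (i - j).val = a ^ i.val * (a ^ j.val)⁻¹ := by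
  rw [eq_mul_inv_iff_mul_eq, ← ZMod.pow_val_add ha, sub_add_cancel]

theorem ZMod.pow_val_natCast {G : Type*} [Group G] {a : G} {M : ℕ} [NeZero M] (ha : orderOf a = M)
    (i : ℕ) : a ^ (i : ZMod M).val = a ^ i := by
  rw [ZMod.val_natCast, ← ha, pow_mod_orderOf]

/-- A group generated by `a` of order `2 * N` together with an element `b` inverting `a` with
`b ^ 2 = a ^ N` is a generalized quaternion group. -/
noncomputable def QuaternionGroup.equivOfConjEqInv {G : Type*} [Group G] {N : ℕ} [NeZero N]
    {a b : G} (ha : orderOf a = 2 * N) (hb : b ∉ zpowers a) (hconj : b * a * b⁻¹ = a⁻¹)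
    (hb2 : b ^ 2 = a ^ N) (hcov : ∀ g, g ∉ zpowers a → b⁻¹ * g ∈ zpowers a) :
    QuaternionGroup N ≃* G := by
  have hba (i : ZMod (2 * N)) : a ^ i.val * b = b * (a ^ i.val)⁻¹ := by
    have h1 : b * (a ^ i.val)⁻¹ * b⁻¹ = a ^ i.val := by
      rw [← conj_inv, ← conj_pow, hconj, inv_pow, inv_inv]
    rw [← mul_inv_eq_iff_eq_mul.mp h1]
  let f : QuaternionGroup N →* G :=
    MonoidHom.mk' (fun | .a i => a ^ i.val | .xa i => b * a ^ i.val) <| by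
      rintro (i | i) (j | j)
      · exact ZMod.pow_val_add ha i j
      · change b * a ^ (j - i).val = a ^ i.val * (b * a ^ j.val)
        rw [sub_eq_neg_add, ZMod.pow_val_add ha, ← mul_assoc, ← mul_assoc, hba, ← zero_sub,
          ZMod.pow_val_sub ha]
        simp
      · change b * a ^ (i + j).val = b * a ^ i.val * a ^ j.val
        rw [ZMod.pow_val_add ha, mul_assoc]
      · change a ^ ((N : ZMod (2 * N)) + j - i).val = b * a ^ i.val * (b * a ^ j.val)
        rw [mul_assoc b, ← mul_assoc _ b, hba, ← mul_assoc, ← mul_assoc, ← pow_two, hb2,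
          sub_eq_add_neg, add_right_comm, ZMod.pow_val_add ha, ZMod.pow_val_add ha,
          ZMod.pow_val_natCast ha, ← zero_sub, ZMod.pow_val_sub ha]
        simp
  refine MulEquiv.ofBijective f ⟨(injective_iff_map_eq_one f).mpr ?_, fun g ↦ ?_⟩
  · rintro (i | i) hi
    · change a ^ i.val = 1 at hi
      rw [← orderOf_dvd_iff_pow_eq_one, ha] at hi
      have := Nat.eq_zero_of_dvd_of_lt hi (ZMod.val_lt i)
      rw [(ZMod.val_eq_zero i).mp this]
      rfl
    · change b * a ^ i.val = 1 at hi
      exact absurd ((eq_inv_of_mul_eq_one_left hi) ▸ inv_mem (pow_mem (mem_zpowers a) _)) hb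
  · have key (g : G) (hg : g ∈ zpowers a) : ∃ i : ZMod (2 * N), a ^ i.val = g := by
      have hfin : IsOfFinOrder a := orderOf_pos_iff.mp (ha ▸ NeZero.pos (2 * N))
      obtain ⟨k, rfl⟩ := hfin.mem_powers_iff_mem_zpowers.mpr hg
      exact ⟨k, ZMod.pow_val_natCast ha k⟩
    by_cases hg : g ∈ zpowers a
    · obtain ⟨i, hi⟩ := key g hg
      exact ⟨.a i, hi⟩
    · obtain ⟨i, hi⟩ := key _ (hcov g hg)
      exact ⟨.xa i, by change b * a ^ i.val = g; rw [hi, mul_inv_cancel_left]⟩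

/-- A finite `p`-group with a unique subgroup of order `p` is cyclic or generalized quaternion. -/
theorem IsPGroup.isCyclic_or_isGeneralizedQuaternion {G : Type*} [Group G] [Finite G] {p : ℕ}
    [hp : Fact p.Prime] (hG : IsPGroup p G) {z : G} (hz : orderOf z = p)
    (huniq : ∀ x : G, x ^ p = 1 → x ∈ zpowers z) :
    IsCyclic G ∨ IsGeneralizedQuaternion G := by
  obtain ⟨a, h⟩ := hG.exists_isSelfCentralizingGenerator hz huniq
  by_cases htop : zpowers a = ⊤
  · exact .inl (isCyclic_iff_exists_zpowers_eq_top.mpr ⟨a, htop⟩)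
  right
  obtain rfl : p = 2 :=
    hp.out.eq_two_or_odd'.resolve_right fun hodd ↦ htop (h.zpowers_eq_top hG hodd)
  rw [eq_top_iff'] at htop
  push Not at htop
  obtain ⟨b, hb⟩ := htop
  have hb2 := h.sq_mem hG b
  obtain ⟨m, hm⟩ := IsPGroup.iff_orderOf.mp hG a
  have h4 := h.four_dvd_orderOf hG hb hb2
  obtain ⟨m, rfl⟩ : ∃ k, m = k + 2 := by
    refine Nat.exists_eq_add_of_le' ?_
    rw [hm, show 4 = 2 ^ 2 from rfl] at h4
    exact (Nat.pow_dvd_pow_iff_le_right one_lt_two).mp h4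
  -- `⟨a⟩` has order `2 ^ (m + 2)` and index 2, so the group is `Q_{2^n}` with `n = m + 3`.
  have hN : orderOf a = 2 * 2 ^ (m + 3 - 2) := by
    rw [hm, ← pow_succ']; rfl
  exact ⟨m + 3, by omega, ⟨(QuaternionGroup.equivOfConjEqInv hN hb (h.conj_eq_inv hG hb hb2)
    (h.sq_eq_pow hG hN hb hb2) fun g hg ↦ h.inv_mul_mem hG hb hg).symm⟩⟩

/-! ### Comparing subgroups by order. -/

theorem IsCyclic.le_of_card_dvd {G : Type*} [Group G] [Finite G] [IsCyclic G] {H K : Subgroup G}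
    (h : Nat.card H ∣ Nat.card K) : H ≤ K := by
  classical
  have := Fintype.ofFinite G
  -- A cyclic group has at most `Nat.card K` solutions of this equation, and `K` already supplies
  -- that many.
  have hK : (K : Set G).toFinset = ({x | x ^ Nat.card K = 1} : Finset G) := by
    refine Finset.eq_of_subset_of_card_le (fun x hx ↦ ?_) ?_
    · simpa using orderOf_dvd_iff_pow_eq_one.mp (orderOf_dvd_natCard K (by simpa using hx))
    · refine (IsCyclic.card_pow_eq_one_le Nat.card_pos).trans ?_
      rw [Set.toFinset_card, ← Nat.card_eq_fintype_card]
      rfl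
  intro x hx
  have : x ∈ (K : Set G).toFinset := by
    rw [hK]
    simpa using orderOf_dvd_iff_pow_eq_one.mp ((orderOf_dvd_natCard H hx).trans h)
  simpa using this

theorem IsPGroup.le_or_le_of_isCyclic {G : Type*} [Group G] [Finite G] [IsCyclic G] {p : ℕ}
    [Fact p.Prime] (hG : IsPGroup p G) (H K : Subgroup G) : H ≤ K ∨ K ≤ H := by
  obtain ⟨i, hi⟩ := IsPGroup.iff_card.mp (hG.to_subgroup H)
  obtain ⟨j, hj⟩ := IsPGroup.iff_card.mp (hG.to_subgroup K)
  rcases le_total i j with hij | hij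
  · exact .inl (IsCyclic.le_of_card_dvd (hi ▸ hj ▸ pow_dvd_pow p hij))
  · exact .inr (IsCyclic.le_of_card_dvd (hi ▸ hj ▸ pow_dvd_pow p hij))

/-- Otherwise `H` contains a Sylow subgroup for every prime, so its order is divisible by that of
`G`. -/
theorem Subgroup.exists_prime_pow_orderOf_notMem {G : Type*} [Group G] [Finite G]
    {H : Subgroup G} (hH : H ≠ ⊤) :
    ∃ q k : ℕ, q.Prime ∧ ∃ x : G, orderOf x = q ^ k ∧ x ∉ H := by
  by_contra! hcon
  refine hH (Subgroup.eq_top_of_card_eq H (Nat.dvd_antisymm H.card_subgroup_dvd_card ?_))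
  rw [← Nat.factorization_prime_le_iff_dvd Nat.card_pos.ne' Nat.card_pos.ne']
  intro q hq
  have : Fact q.Prime := ⟨hq⟩
  let P : Sylow q G := default
  have hPH : (P : Subgroup G) ≤ H := by
    intro x hx
    obtain ⟨k, hk⟩ := IsPGroup.iff_orderOf.mp P.isPGroup' ⟨x, hx⟩
    exact hcon q k hq x (by rwa [Subgroup.orderOf_mk] at hk)
  rw [← hq.pow_dvd_iff_le_factorization Nat.card_pos.ne', ← P.card_eq_multiplicity]
  exact Subgroup.card_dvd_of_le hPH

theorem Subgroup.zpowers_mem_cyclicSubgroups {G : Type*} [Group G] (x : G) :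
    zpowers x ∈ cyclicSubgroups G :=
  inferInstanceAs (IsCyclic (zpowers x))

/-! ### Consequences of having a breaking point. -/

namespace IsBreakingPoint

variable {G : Type*} [Group G] {H : Subgroup G}

theorem exists_isPGroup [Finite G] (hH : IsBreakingPoint (cyclicSubgroups G) H) :
    ∃ p : ℕ, p.Prime ∧ IsPGroup p G := by
  obtain ⟨hcyc, hbot, htop, hcomp⟩ := hH
  obtain ⟨p, k, hp, y, hy, hyH⟩ := Subgroup.exists_prime_pow_orderOf_notMem htop
  have : Fact p.Prime := ⟨hp⟩
  have hHy : H ≤ zpowers y :=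
    (hcomp _ (zpowers_mem_cyclicSubgroups y)).resolve_left fun h ↦ hyH (h (mem_zpowers y))
  have hHp : IsPGroup p H := (IsPGroup.of_card (by rw [Nat.card_zpowers, hy])).to_le hHy
  refine ⟨p, hp, IsPGroup.of_card
    (Nat.eq_prime_pow_of_unique_prime_dvd Nat.card_pos.ne' fun {q} hq hqd ↦ ?_)⟩
  have : Fact q.Prime := ⟨hq⟩
  obtain ⟨x, hx⟩ := exists_prime_orderOf_dvd_card' q hqd
  rcases hcomp _ (zpowers_mem_cyclicSubgroups x) with h | h
  · obtain ⟨i, hi⟩ := IsPGroup.iff_orderOf.mp hHp ⟨x, h (mem_zpowers x)⟩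
    rw [Subgroup.orderOf_mk, hx] at hi
    exact (Nat.prime_dvd_prime_iff_eq hq hp).mp (hq.dvd_of_dvd_pow hi.dvd)
  · have h1 := hHp.card_eq_or_dvd.resolve_left fun h ↦ hbot (Subgroup.card_eq_one.mp h)
    have h2 := h1.trans (Subgroup.card_dvd_of_le h)
    rw [Nat.card_zpowers, hx] at h2
    exact ((Nat.prime_dvd_prime_iff_eq hp hq).mp h2).symm

theorem exists_orderOf_eq [Finite G] (hH : IsBreakingPoint (cyclicSubgroups G) H) {p : ℕ}
    [hp : Fact p.Prime] (hG : IsPGroup p G) :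
    ∃ z ∈ H, orderOf z = p ∧ ∀ x : G, x ^ p = 1 → x ∈ zpowers z := by
  obtain ⟨hcyc, hbot, htop, hcomp⟩ := hH
  obtain ⟨⟨z, hzH⟩, hz⟩ := exists_prime_orderOf_dvd_card' p
    ((hG.to_subgroup H).card_eq_or_dvd.resolve_left fun h ↦ hbot (Subgroup.card_eq_one.mp h))
  rw [Subgroup.orderOf_mk] at hz
  refine ⟨z, hzH, hz, fun x hx ↦ ?_⟩
  have hcx : Nat.card (zpowers x) ∣ p := by
    rw [Nat.card_zpowers]; exact orderOf_dvd_of_pow_eq_one hx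
  rcases hcomp _ (zpowers_mem_cyclicSubgroups x) with h | h
  · have : IsCyclic H := hcyc
    have h1 : (zpowers x).subgroupOf H ≤ (zpowers z).subgroupOf H := by
      apply IsCyclic.le_of_card_dvd
      rw [Nat.card_congr (subgroupOfEquivOfLe h).toEquiv,
        Nat.card_congr (subgroupOfEquivOfLe (zpowers_le.mpr hzH)).toEquiv, Nat.card_zpowers z, hz]
      exact hcx
    exact h1 (show (⟨x, h (mem_zpowers x)⟩ : H) ∈ (zpowers x).subgroupOf H from mem_zpowers x)
  · have h1 : zpowers z ≤ zpowers x := zpowers_le.mpr (h hzH)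
    rw [Subgroup.eq_of_le_of_card_ge h1]
    · exact mem_zpowers x
    · rw [Nat.card_zpowers z, hz]
      exact Nat.le_of_dvd hp.out.pos hcx

end IsBreakingPoint

/-- A proper subgroup of order `p` containing all solutions of `x ^ p = 1` in a finite `p`-group
is a breaking point. -/
theorem IsPGroup.isBreakingPoint {G : Type*} [Group G] [Finite G] {p : ℕ} [hp : Fact p.Prime]
    (hG : IsPGroup p G) {H : Subgroup G} (hH : Nat.card H = p) (hne : H ≠ ⊤)
    (huniq : ∀ x : G, orderOf x = p → zpowers x = H) :
    IsBreakingPoint (cyclicSubgroups G) H := by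
  refine ⟨isCyclic_of_prime_card hH, fun h ↦ ?_, hne, fun X _ ↦ ?_⟩
  · rw [h, Subgroup.card_bot] at hH
    exact hp.out.one_lt.ne hH
  · by_cases hX : X = ⊥
    · exact .inl (hX ▸ bot_le)
    · obtain ⟨⟨x, hxX⟩, hx⟩ := exists_prime_orderOf_dvd_card' p
        ((hG.to_subgroup X).card_eq_or_dvd.resolve_left fun h ↦ hX (Subgroup.card_eq_one.mp h))
      rw [Subgroup.orderOf_mk] at hx
      right
      rw [← huniq x hx]
      exact zpowers_le.mpr hxX

/-! ### Breaking points of generalized quaternion groups. -/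

namespace QuaternionGroup

variable {N : ℕ} [NeZero N]

theorem a_mem_zpowers_a_one (i : ZMod (2 * N)) : a i ∈ zpowers (a 1 : QuaternionGroup N) :=
  mem_powers_iff_mem_zpowers.mp ⟨i.val, by simp⟩

theorem xa_notMem_zpowers_a (i j : ZMod (2 * N)) : xa i ∉ zpowers (a j : QuaternionGroup N) := by
  intro h
  have h1 := (zpowers_le.mpr (a_mem_zpowers_a_one j)) h
  obtain ⟨k, hk⟩ := mem_powers_iff_mem_zpowers.mpr h1
  simp at hk

theorem eq_a_of_orderOf_eq_two {g : QuaternionGroup N} (hg : orderOf g = 2) : g = a N := by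
  rcases g with i | i
  · rw [← a_one_pow]
    refine zpow_eq_pow_of_sq_eq_one orderOf_a_one (a_mem_zpowers_a_one i) ?_ fun h ↦ ?_
    · rw [← hg, pow_orderOf_eq_one]
    · simp [h] at hg
  · simp at hg

theorem orderOf_a_natCast : orderOf (a N : QuaternionGroup N) = 2 := by
  refine orderOf_eq_prime (by rw [← xa_sq 0, ← pow_mul]; simp) fun h ↦ ?_
  have h1 := orderOf_dvd_of_pow_eq_one ((xa_sq (n := N) 0).trans h)
  rw [orderOf_xa] at h1
  omega

/-- Powers of `a j` never leave `⟨a 1⟩`, and every `xa j` has order 4, so `⟨xa i⟩` is maximal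
cyclic. -/
theorem mem_zpowers_xa {g : QuaternionGroup N} {i : ZMod (2 * N)} (h : xa i ∈ zpowers g) :
    g ∈ zpowers (xa i) := by
  rcases g with j | j
  · exact absurd h (xa_notMem_zpowers_a i j)
  · rw [Subgroup.eq_of_le_of_card_ge (zpowers_le.mpr h) 
      (by rw [Nat.card_zpowers, Nat.card_zpowers, orderOf_xa, orderOf_xa])]
    exact mem_zpowers _

theorem xa_one_notMem_zpowers_xa_zero (hN : 2 ≤ N) :
    (xa 1 : QuaternionGroup N) ∉ zpowers (xa 0) := by
  intro h
  rw [mem_zpowers_iff_mem_range_orderOf, orderOf_xa] at h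
  obtain ⟨k, hk, h⟩ := Finset.mem_image.mp h
  have h1 : (1 : ZMod (2 * N)) ≠ 0 := by
    have : Fact (1 < 2 * N) := ⟨by omega⟩
    exact one_ne_zero
  -- The cube of `xa 0` is `xa (-N)`; this and `xa 0` are its only powers outside `⟨a 1⟩`.
  have h2 : (1 : ZMod (2 * N)) ≠ -N := by
    rw [Ne, eq_neg_iff_add_eq_zero]
    intro h
    have h3 : ((1 + N : ℕ) : ZMod (2 * N)) = 0 := by push_cast; exact h
    rw [ZMod.natCast_eq_zero_iff] at h3
    have := Nat.le_of_dvd (by omega) h3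
    omega
  rw [Finset.mem_range] at hk
  interval_cases k
  · rw [pow_zero, one_def] at h
    injection h
  · rw [pow_one] at h
    injection h with h
    exact h1 h.symm
  · rw [xa_sq] at h
    injection h
  · rw [pow_succ, xa_sq, a_mul_xa] at h
    injection h with h
    exact h2 (by rw [← h, zero_sub])

end QuaternionGroup

theorem MulEquiv.map_mem_zpowers_iff {G K : Type*} [Group G] [Group K] (e : G ≃* K) {x g : G} :
    e x ∈ zpowers (e g) ↔ x ∈ zpowers g := by
  simp only [mem_zpowers_iff, ← map_zpow, e.injective.eq_iff]

namespace IsGeneralizedQuaternion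

variable {G : Type*} [Group G]

theorem isPGroup (h : IsGeneralizedQuaternion G) : IsPGroup 2 G := by
  obtain ⟨n, hn, ⟨e⟩⟩ := h
  refine IsPGroup.of_card (n := n) ?_
  rw [Nat.card_congr e.toEquiv, Nat.card_eq_fintype_card, QuaternionGroup.card,
    show 4 = 2 ^ 2 from rfl, ← pow_add]
  congr 1
  omega

theorem exists_unique_involution (h : IsGeneralizedQuaternion G) :
    ∃ z : G, orderOf z = 2 ∧ ∀ g : G, orderOf g = 2 → g = z := by
  obtain ⟨n, hn, ⟨e⟩⟩ := h
  refine ⟨e.symm (.a (2 ^ (n - 2) : ℕ)), ?_, fun g hg ↦ ?_⟩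
  · rw [MulEquiv.orderOf_eq, QuaternionGroup.orderOf_a_natCast]
  · rw [MulEquiv.eq_symm_apply]
    exact QuaternionGroup.eq_a_of_orderOf_eq_two (by rwa [MulEquiv.orderOf_eq])

/-- A generalized quaternion group has two distinct maximal cyclic subgroups of order `4`. -/
theorem exists_maximal_cyclic (h : IsGeneralizedQuaternion G) :
    ∃ x y : G, orderOf x = 4 ∧ orderOf y = 4 ∧ y ∉ zpowers x ∧
      (∀ g : G, x ∈ zpowers g → g ∈ zpowers x) ∧ ∀ g : G, y ∈ zpowers g → g ∈ zpowers y := by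
  obtain ⟨n, hn, ⟨e⟩⟩ := h
  have key (i : ZMod (2 * 2 ^ (n - 2))) (g : G) (hg : e.symm (.xa i) ∈ zpowers g) :
      g ∈ zpowers (e.symm (.xa i)) := by
    rw [← e.map_mem_zpowers_iff, MulEquiv.apply_symm_apply] at hg ⊢
    exact QuaternionGroup.mem_zpowers_xa hg
  refine ⟨e.symm (.xa 0), e.symm (.xa 1), ?_, ?_, ?_, key 0, key 1⟩
  · rw [MulEquiv.orderOf_eq, QuaternionGroup.orderOf_xa]
  · rw [MulEquiv.orderOf_eq, QuaternionGroup.orderOf_xa]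
  · rw [e.symm.map_mem_zpowers_iff]
    exact QuaternionGroup.xa_one_notMem_zpowers_xa_zero (Nat.le_self_pow (by omega) 2)

theorem not_isCyclic (h : IsGeneralizedQuaternion G) : ¬ IsCyclic G := by
  intro hc
  obtain ⟨x, y, -, -, hxy, hx, -⟩ := h.exists_maximal_cyclic
  obtain ⟨g, hg⟩ := IsCyclic.exists_generator (α := G)
  exact hxy ((zpowers_le.mpr (hx g (hg x))) (hg y))

variable [Finite G]

theorem existsUnique_card_eq_two (h : IsGeneralizedQuaternion G) :
    ∃! H : Subgroup G, Nat.card H = 2 := by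
  obtain ⟨z, hz, huniq⟩ := h.exists_unique_involution
  refine ⟨zpowers z, (Nat.card_zpowers z).trans hz, fun K hK ↦ ?_⟩
  obtain ⟨⟨x, hxK⟩, hx⟩ := exists_prime_orderOf_dvd_card' (G := K) 2 hK.symm.dvd
  rw [Subgroup.orderOf_mk] at hx
  obtain rfl := huniq x hx
  exact (Subgroup.eq_of_le_of_card_ge (zpowers_le.mpr hxK) (by rw [Nat.card_zpowers, hK, hx])).symm

theorem isBreakingPoint_iff (h : IsGeneralizedQuaternion G) (H : Subgroup G) :
    IsBreakingPoint (cyclicSubgroups G) H ↔ Nat.card H = 2 := by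
  constructor
  · rintro ⟨hcyc, hbot, -, hcomp⟩
    obtain ⟨g, rfl⟩ := H.isCyclic_iff_exists_zpowers_eq_top.mp hcyc
    obtain ⟨x, y, hx, hy, hxy, hmx, hmy⟩ := h.exists_maximal_cyclic
    have hgx : g ∈ zpowers x := (hcomp _ (zpowers_mem_cyclicSubgroups x)).elim
      (fun h ↦ hmx g (h (mem_zpowers x))) fun h ↦ h (mem_zpowers g)
    have hgy : g ∈ zpowers y := (hcomp _ (zpowers_mem_cyclicSubgroups y)).elim
      (fun h ↦ hmy g (h (mem_zpowers y))) fun h ↦ h (mem_zpowers g)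
    rw [Nat.card_zpowers]
    have h4 : orderOf g ∣ 2 ^ 2 := (orderOf_dvd_of_mem_zpowers hgx).trans hx.dvd
    obtain ⟨i, hi, hgi⟩ := (Nat.dvd_prime_pow Nat.prime_two).mp h4
    interval_cases i
    · exact absurd (zpowers_eq_bot.mpr (orderOf_eq_one_iff.mp hgi)) hbot
    · exact hgi
    · have h1 : zpowers g = zpowers x := Subgroup.eq_of_le_of_card_ge (zpowers_le.mpr hgx)
        (by rw [Nat.card_zpowers, Nat.card_zpowers, hx, hgi]; rfl)
      have h2 : zpowers g = zpowers y := Subgroup.eq_of_le_of_card_ge (zpowers_le.mpr hgy)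
        (by rw [Nat.card_zpowers, Nat.card_zpowers, hy, hgi]; rfl)
      exact absurd (h1 ▸ h2 ▸ mem_zpowers y) hxy
  · intro hH
    refine h.isPGroup.isBreakingPoint hH ?_ fun x hx ↦
      h.existsUnique_card_eq_two.unique ((Nat.card_zpowers x).trans hx) hH
    rintro rfl
    have := isCyclic_of_prime_card hH
    exact h.not_isCyclic (isCyclic_of_surjective (Subgroup.topEquiv (G := G)) topEquiv.surjective)

theorem existsUnique_isBreakingPoint (h : IsGeneralizedQuaternion G) :
    ∃! H : Subgroup G, IsBreakingPoint (cyclicSubgroups G) H := by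
  simpa only [h.isBreakingPoint_iff] using h.existsUnique_card_eq_two

end IsGeneralizedQuaternion

/-! ### Breaking points of cyclic `p`-groups. -/

theorem IsPGroup.isBreakingPoint_iff_of_isCyclic {G : Type*} [Group G] [Finite G] [IsCyclic G]
    {p : ℕ} [Fact p.Prime] (hG : IsPGroup p G) {H : Subgroup G} :
    IsBreakingPoint (cyclicSubgroups G) H ↔ H ≠ ⊥ ∧ H ≠ ⊤ :=
  ⟨fun h ↦ ⟨h.2.1, h.2.2.1⟩, fun h ↦
    ⟨Subgroup.isCyclic H, h.1, h.2, fun X _ ↦ hG.le_or_le_of_isCyclic X H⟩⟩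

theorem existsUnique_isBreakingPoint_of_card_eq_sq {G : Type*} [Group G] [Finite G] [IsCyclic G]
    {p : ℕ} (hp : p.Prime) (hG : Nat.card G = p ^ 2) :
    ∃! H : Subgroup G, IsBreakingPoint (cyclicSubgroups G) H := by
  have : Fact p.Prime := ⟨hp⟩
  have hiff (H : Subgroup G) : IsBreakingPoint (cyclicSubgroups G) H ↔ Nat.card H = p := by
    rw [(IsPGroup.of_card hG).isBreakingPoint_iff_of_isCyclic, Ne, Ne, ← Subgroup.card_eq_one,
      ← Subgroup.card_eq_iff_eq_top, hG]
    constructor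
    · rintro ⟨h1, h2⟩
      obtain ⟨i, hi, hHi⟩ := (Nat.dvd_prime_pow hp).mp (hG ▸ H.card_subgroup_dvd_card)
      interval_cases i
      · exact absurd hHi h1
      · simpa using hHi
      · exact absurd hHi h2
    · rintro h
      rw [h]
      exact ⟨hp.one_lt.ne', (lt_self_pow₀ hp.one_lt one_lt_two).ne⟩
  simp only [hiff]
  obtain ⟨K, hK⟩ := Sylow.exists_subgroup_card_pow_prime (G := G) p (n := 1)
    (hG ▸ pow_dvd_pow p one_le_two)
  rw [pow_one] at hK
  exact ⟨K, hK, fun L hL ↦ le_antisymm (IsCyclic.le_of_card_dvd (by rw [hK, hL]))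
    (IsCyclic.le_of_card_dvd (by rw [hK, hL]))⟩

theorem IsPGroup.card_eq_sq_of_existsUnique_isBreakingPoint {G : Type*} [Group G] [Finite G]
    [IsCyclic G] {p : ℕ} [hp : Fact p.Prime] (hG : IsPGroup p G)
    (h : ∃! H : Subgroup G, IsBreakingPoint (cyclicSubgroups G) H) : Nat.card G = p ^ 2 := by
  obtain ⟨n, hn⟩ := IsPGroup.iff_card.mp hG
  have hbp (i : ℕ) (hi : 0 < i) (hin : i < n) : ∃ K : Subgroup G,
      Nat.card K = p ^ i ∧ IsBreakingPoint (cyclicSubgroups G) K := by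
    obtain ⟨K, hK⟩ := Sylow.exists_subgroup_card_pow_prime (G := G) p (n := i)
      (hn ▸ pow_dvd_pow p hin.le)
    refine ⟨K, hK, hG.isBreakingPoint_iff_of_isCyclic.mpr ⟨?_, ?_⟩⟩
    · rw [Ne, ← Subgroup.card_eq_one, hK]
      exact (Nat.one_lt_pow hi.ne' hp.out.one_lt).ne'
    · rw [Ne, ← Subgroup.card_eq_iff_eq_top, hK, hn]
      exact (Nat.pow_lt_pow_right hp.out.one_lt hin).ne
  have h2 : 2 ≤ n := by
    obtain ⟨H, hH, -⟩ := h
    obtain ⟨hbot, htop⟩ := hG.isBreakingPoint_iff_of_isCyclic.mp hH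
    rw [Ne, ← Subgroup.card_eq_one] at hbot
    rw [Ne, ← Subgroup.card_eq_iff_eq_top, hn] at htop
    obtain ⟨i, hi, hHi⟩ := (Nat.dvd_prime_pow hp.out).mp (hn ▸ H.card_subgroup_dvd_card)
    have hi0 : i ≠ 0 := by rintro rfl; exact hbot hHi
    have hin : i ≠ n := by rintro rfl; exact htop hHi
    omega
  -- The breaking points of orders `p` and `p ^ (n - 1)` must coincide, so `n = 2`.
  obtain ⟨K, hK, hKb⟩ := hbp 1 one_pos (by omega)
  obtain ⟨L, hL, hLb⟩ := hbp (n - 1) (by omega) (by omega)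
  rw [h.unique hKb hLb, hL] at hK
  have := Nat.pow_right_injective hp.out.two_le hK
  rw [hn, show n = 2 by omega]

theorem corollary2p2 (G : Type*) [Group G] [Finite G] :
    ((∃! H : Subgroup G, IsBreakingPoint (cyclicSubgroups G) H) ↔
      (IsCyclic G ∧ ∃ p : ℕ, p.Prime ∧ Nat.card G = p ^ 2) ∨ IsGeneralizedQuaternion G) ∧
    ((¬ IsCyclic G ∧ ∃! H : Subgroup G, IsBreakingPoint (cyclicSubgroups G) H) ↔
      IsGeneralizedQuaternion G) ∧
    (IsGeneralizedQuaternion G →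
      (∃! H : Subgroup G, Nat.card H = 2) ∧
      ∀ H : Subgroup G, IsBreakingPoint (cyclicSubgroups G) H ↔ Nat.card H = 2) := by
  have key : (∃! H : Subgroup G, IsBreakingPoint (cyclicSubgroups G) H) ↔
      (IsCyclic G ∧ ∃ p : ℕ, p.Prime ∧ Nat.card G = p ^ 2) ∨ IsGeneralizedQuaternion G := by
    refine ⟨fun h ↦ ?_, ?_⟩
    · obtain ⟨H, hH, -⟩ := id h
      obtain ⟨p, hp, hG⟩ := hH.exists_isPGroup
      have : Fact p.Prime := ⟨hp⟩
      obtain ⟨z, -, hz, huniq⟩ := hH.exists_orderOf_eq hG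
      refine (hG.isCyclic_or_isGeneralizedQuaternion hz huniq).imp_left fun hc ↦ ?_
      have : IsCyclic G := hc
      exact ⟨hc, p, hp, hG.card_eq_sq_of_existsUnique_isBreakingPoint h⟩
    · rintro (⟨hc, p, hp, hG⟩ | hQ)
      · exact existsUnique_isBreakingPoint_of_card_eq_sq hp hG
      · exact hQ.existsUnique_isBreakingPoint
  refine ⟨key, ⟨fun ⟨hc, h⟩ ↦ ?_, fun h ↦ ⟨h.not_isCyclic, h.existsUnique_isBreakingPoint⟩⟩,
    fun h ↦ ⟨h.existsUnique_card_eq_two, h.isBreakingPoint_iff⟩⟩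
  exact (key.mp h).resolve_left fun h ↦ hc h.1
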